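/- Let $\mathbb T=\mathbb R/2\pi\mathbb Z$. For $f\in L_1(\mathbb T)$ put $$\widehat f_k=\frac1{2\pi}\int_{-\pi}^{\pi}f(t)e^{-ikt}\,dt,\qquad s_m(f;x)=\sum_{k=-m}^{m}\widehat f_k e^{ikx},\qquad \sigma_n(f;x)=\frac1{n+1}\sum_{m=0}^{n}s_m(f;x),$$ so that $\sigma_n(f;x)$ are the Fejér $(C,1)$ means of the Fourier series of $f$. A point $x$ is called a $d$-point of $f$ if the finite limit $$d_f(x)=\lim_{h\to0}\frac1h\int_0^h f(x+t)\,dt$$ exists (where $h$ takes both signs). Then there exists a function $f\in L_1(\mathbb T)$ such that $x=0$ is a $d$-point of $f$, but the sequence $\sigma_n(f;0)$ diverges as $n\to\infty$, that is, it has no finite limit. -/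

import Mathlib

open MeasureTheory Filter Topology

noncomputable section

/-- The circle `𝕋 = ℝ / 2πℤ`. -/
abbrev Torus : Type := AddCircle (2 * Real.pi)

instance fact_two_pi_pos : Fact (0 < 2 * Real.pi) :=
  ⟨Real.two_pi_pos⟩

/-- `x` is a `d`-point of `f` with value `d`: the averages `(1/h) ∫₀ʰ f (x + t) dt` tend to `d`
as `h → 0`, `h ≠ 0` (both signs of `h` are allowed). -/
def IsDPointWithValue (f : Torus → ℂ) (x : Torus) (d : ℂ) : Prop :=
  Tendsto (fun h : ℝ => (h : ℂ)⁻¹ * ∫ t in (0 : ℝ)..h, f (x + (t : Torus))) (𝓝[≠] 0) (𝓝 d)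

/-- `x` is a `d`-point of `f`: the indefinite integral of `f` is differentiable at `x`,
with finite derivative. -/
def IsDPoint (f : Torus → ℂ) (x : Torus) : Prop :=
  ∃ d : ℂ, IsDPointWithValue f x d

/-- The symmetric partial sum `s_m(f; x) = ∑_{k=-m}^{m} f̂(k) e^{ikx}` of the Fourier series,
with `f̂(k) = (1/2π) ∫_{-π}^{π} f(t) e^{-ikt} dt`. -/
def fourierPartialSum (m : ℕ) (f : Torus → ℂ) (x : Torus) : ℂ :=
  ∑ k ∈ Finset.Icc (-(m : ℤ)) (m : ℤ), fourierCoeff f k * fourier k x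

/-- The Fejér `(C,1)` mean `σ_n(f; x) = (1/(n+1)) ∑_{m=0}^{n} s_m(f; x)`. -/
def fejerMean (n : ℕ) (f : Torus → ℂ) (x : Torus) : ℂ :=
  ((n : ℂ) + 1)⁻¹ * ∑ m ∈ Finset.range (n + 1), fourierPartialSum m f x

end

/-! The function is a gliding-hump sum `∑ c_j b_{j+1}` with `c ∈ ℓ¹`. The bumps `b_m` have `L¹` norm
at most 1, and oscillation keeps their primitives at most `2|h|`, uniformly in `m`, and `O(h²)` for
each fixed `m`. By dominated convergence 0 is therefore a `d`-point, with value 0, for every such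
`c`.

The Fejér kernel of order `n = m² - 1` resonates with `b_m`: near 0 the product is about `2 cos u (1
- cos u) / t` with `u = m² t`. Since `cos u (1 - cos u)` has mean `-1/2`, its integral over `(0,
1/m]` is at most `12 - log m` (`log_sub_le_norm_integral_fejerKernel_mul_oscBump`). The functionals
`c ↦ σ_n(f; 0)` on `ℓ¹` are thus not uniformly bounded, and Banach–Steinhaus
(`exists_summable_norm_not_tendsto_tsum`) supplies a divergent choice of `c`. -/

theorem integrable_tsum_of_summable_integral_norm {α : Type*} [MeasurableSpace α] {μ : Measure α}
    {F : ℕ → α → ℂ} (hm : ∀ i, Measurable (F i)) (hF : ∀ i, Integrable (F i) μ)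
    (hs : Summable fun i => ∫ a, ‖F i a‖ ∂μ) : Integrable (fun a => ∑' i, F i a) μ := by
  refine ⟨(Measurable.tsum hm).aestronglyMeasurable, ?_⟩
  calc ∫⁻ a, ‖∑' i, F i a‖ₑ ∂μ ≤ ∫⁻ a, ∑' i, ‖F i a‖ₑ ∂μ :=
        lintegral_mono fun a => enorm_tsum_le_tsum_enorm
    _ = ∑' i, ∫⁻ a, ‖F i a‖ₑ ∂μ := lintegral_tsum fun i => (hm i).enorm.aemeasurable
    _ = ∑' i, ENNReal.ofReal (∫ a, ‖F i a‖ ∂μ) := by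
        congr with i
        rw [ofReal_integral_norm_eq_lintegral_enorm (hF i)]
    _ < ⊤ := hs.tsum_ofReal_lt_top

/-- For a bounded measurable weight `φ`, integration against `φ` commutes with an absolutely
convergent combination of functions from the unit ball of `L¹`. -/
theorem hasSum_integral_mul_tsum {α : Type*} [MeasurableSpace α] {μ : Measure α}
    {G : ℕ → α → ℂ} (hG : ∀ i, Integrable (G i) μ) (hle : ∀ i, ∫ a, ‖G i a‖ ∂μ ≤ 1)
    {c : ℕ → ℂ} (hc : Summable fun i => ‖c i‖) {φ : α → ℂ} (hφ : AEStronglyMeasurable φ μ) {C : ℝ}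
    (hC : ∀ a, ‖φ a‖ ≤ C) :
    HasSum (fun i => c i * ∫ a, φ a * G i a ∂μ) (∫ a, φ a * ∑' i, c i * G i a ∂μ) := by
  have hint : ∀ i, Integrable (fun a => φ a * G i a) μ := fun i =>
    (hG i).bdd_mul hφ (ae_of_all _ hC)
  have key := hasSum_integral_of_summable_integral_norm (F := fun i a => c i * (φ a * G i a))
    (fun i => (hint i).const_mul (c i)) (μ := μ) ?_
  · simp_rw [integral_const_mul] at key
    have (a : α) : ∑' i, c i * (φ a * G i a) = φ a * ∑' i, c i * G i a := by
      rw [← tsum_mul_left]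
      exact tsum_congr fun i => mul_left_comm _ _ _
    simpa only [this] using key
  · refine Summable.of_nonneg_of_le (fun i => by positivity) (fun i => ?_) (hc.mul_right |C|)
    simp_rw [norm_mul, integral_const_mul]
    gcongr
    calc ∫ a, ‖φ a‖ * ‖G i a‖ ∂μ ≤ ∫ a, |C| * ‖G i a‖ ∂μ := by
          refine integral_mono (by simpa using (hint i).norm) ((hG i).norm.const_mul _) fun a => ?_
          dsimp only
          gcongr
          exact (hC a).trans (le_abs_self C)
      _ = |C| * ∫ a, ‖G i a‖ ∂μ := integral_const_mul _ _
      _ ≤ |C| := mul_le_of_le_one_right (abs_nonneg C) (hle i)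

/-! ### Oscillating bumps and their primitives -/

/-- The oscillating bump `m² t cos (m² t)` on `(0, 1/m]`. -/
noncomputable def oscBump (m : ℝ) : ℝ → ℝ :=
  (Set.Ioc 0 m⁻¹).indicator fun t => m ^ 2 * t * Real.cos (m ^ 2 * t)

theorem measurable_oscBump (m : ℝ) : Measurable (oscBump m) :=
  Measurable.indicator (by fun_prop) measurableSet_Ioc

theorem integrable_oscBump (m : ℝ) : Integrable (oscBump m) := by
  refine IntegrableOn.integrable_indicator ?_ measurableSet_Ioc
  exact (Continuous.integrableOn_Icc (by fun_prop)).mono_set Set.Ioc_subset_Icc_self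

theorem abs_oscBump_le (m t : ℝ) : |oscBump m t| ≤ m ^ 2 * |t| := by
  unfold oscBump
  by_cases h : t ∈ Set.Ioc 0 m⁻¹
  · rw [Set.indicator_of_mem h, abs_mul, abs_mul, abs_of_nonneg (sq_nonneg m)]
    exact mul_le_of_le_one_right (by positivity) (Real.abs_cos_le_one _)
  · rw [Set.indicator_of_notMem h, abs_zero]
    positivity

theorem integral_abs_oscBump_le {m : ℝ} (hm : 0 < m) : ∫ t, |oscBump m t| ≤ 1 := by
  have h (t : ℝ) : |oscBump m t| ≤ (Set.Ioc 0 m⁻¹).indicator (fun _ => m) t := by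
    by_cases ht : t ∈ Set.Ioc 0 m⁻¹
    · rw [Set.indicator_of_mem ht]
      refine (abs_oscBump_le m t).trans ?_
      rw [abs_of_pos ht.1]
      calc m ^ 2 * t ≤ m ^ 2 * m⁻¹ := by gcongr; exact ht.2
        _ = m := by field_simp
    · rw [Set.indicator_of_notMem ht, oscBump, Set.indicator_of_notMem ht, abs_zero]
  refine (integral_mono (integrable_oscBump m).abs ?_ h).trans ?_
  · exact IntegrableOn.integrable_indicator (by simp) measurableSet_Ioc
  · rw [integral_indicator measurableSet_Ioc]
    simp [hm.le, hm.ne']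

theorem abs_integral_oscBump_le_sq (m h : ℝ) : |∫ t in (0 : ℝ)..h, oscBump m t| ≤ m ^ 2 * h ^ 2 := by
  have := intervalIntegral.norm_integral_le_of_norm_le_const (a := 0) (b := h) (f := oscBump m)
    (C := m ^ 2 * |h|) fun t ht => ?_
  · rw [Real.norm_eq_abs, sub_zero, mul_assoc, abs_mul_abs_self] at this
    linarith
  · refine (abs_oscBump_le m t).trans ?_
    have : |t| ≤ |h| := by
      simpa using Set.abs_sub_left_of_mem_uIcc (Set.uIoc_subset_uIcc ht)
    gcongr

theorem integral_oscBump_of_le {m h : ℝ} (hm : 0 < m) (h0 : 0 ≤ h) (hh : h ≤ m⁻¹) :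
    ∫ t in (0 : ℝ)..h, oscBump m t =
      h * Real.sin (m ^ 2 * h) + (Real.cos (m ^ 2 * h) - 1) / m ^ 2 := by
  have hcongr : ∫ t in (0 : ℝ)..h, oscBump m t =
      ∫ t in (0 : ℝ)..h, m ^ 2 * t * Real.cos (m ^ 2 * t) := by
    simp_rw [intervalIntegral.integral_of_le h0]
    refine setIntegral_congr_fun measurableSet_Ioc fun t ht => ?_
    exact Set.indicator_of_mem (Set.Ioc_subset_Ioc_right hh ht) _
  rw [hcongr, intervalIntegral.integral_eq_sub_of_hasDerivAt
    (f := fun t => t * Real.sin (m ^ 2 * t) + (Real.cos (m ^ 2 * t) - 1) / m ^ 2)]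
  · simp
  · intro t _
    have hl : HasDerivAt (fun t : ℝ => m ^ 2 * t) (m ^ 2) t := by
      simpa using (hasDerivAt_id t).const_mul (m ^ 2)
    convert! ((hasDerivAt_id t).mul hl.sin).add ((hl.cos.sub_const 1).div_const (m ^ 2)) using 1
    simp only [id]
    field_simp
    ring
  · exact Continuous.intervalIntegrable (by fun_prop) _ _

/-- In the closed form of the primitive both terms are at most `h`, the second because `1 - cos y ≤
y` for `y ≥ 0`; beyond `1/m` the primitive is constant. Uniformity in `m` provides the dominating
series later. -/
theorem abs_integral_oscBump_le {m : ℝ} (hm : 0 < m) (h : ℝ) :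
    |∫ t in (0 : ℝ)..h, oscBump m t| ≤ 2 * |h| := by
  rcases le_total h 0 with h0 | h0
  · have : ∫ t in (0 : ℝ)..h, oscBump m t = 0 := by
      rw [intervalIntegral.integral_of_ge h0, setIntegral_eq_zero_of_forall_eq_zero, neg_zero]
      intro t ht
      exact Set.indicator_of_notMem (fun h' => h'.1.not_ge ht.2) _
    rw [this, abs_zero]
    positivity
  · have aux {x : ℝ} (hx : 0 ≤ x) (hxm : x ≤ m⁻¹) :
        |∫ t in (0 : ℝ)..x, oscBump m t| ≤ 2 * x := by
      rw [integral_oscBump_of_le hm hx hxm]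
      have h1 : |x * Real.sin (m ^ 2 * x)| ≤ x := by
        rw [abs_mul, abs_of_nonneg hx]
        exact mul_le_of_le_one_right hx (Real.abs_sin_le_one _)
      have h2 : |(Real.cos (m ^ 2 * x) - 1) / m ^ 2| ≤ x := by
        rw [abs_div, abs_of_pos (by positivity : 0 < m ^ 2), div_le_iff₀ (by positivity)]
        have hy : 0 ≤ m ^ 2 * x := by positivity
        have hcos := Real.one_sub_sq_div_two_le_cos (x := m ^ 2 * x)
        rw [abs_sub_comm, abs_of_nonneg (by linarith [Real.cos_le_one (m ^ 2 * x)])]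
        rcases le_total (m ^ 2 * x) 2 with h2 | h2
        · nlinarith
        · linarith [Real.neg_one_le_cos (m ^ 2 * x)]
      linarith [abs_add_le (x * Real.sin (m ^ 2 * x)) ((Real.cos (m ^ 2 * x) - 1) / m ^ 2)]
    rw [abs_of_nonneg h0]
    rcases le_total h m⁻¹ with hh | hh
    · exact aux h0 hh
    · have hi (a b : ℝ) : IntervalIntegrable (oscBump m) volume a b :=
        (integrable_oscBump m).intervalIntegrable
      rw [← intervalIntegral.integral_add_adjacent_intervals (hi 0 m⁻¹) (hi m⁻¹ h)]
      have : ∫ t in m⁻¹..h, oscBump m t = 0 := by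
        rw [intervalIntegral.integral_of_le hh, setIntegral_eq_zero_of_forall_eq_zero]
        intro t ht
        exact Set.indicator_of_notMem (fun h' => h'.2.not_gt ht.1) _
      rw [this, add_zero]
      exact (aux (by positivity) le_rfl).trans (by linarith)

/-! ### Closed form of the Fejér kernel -/

/-- The Fejér kernel `(1/(n+1)) ∑_{m=0}^{n} ∑_{k=-m}^{m} e^{-ikt}`. -/
noncomputable def fejerKernel (n : ℕ) (t : ℝ) : ℂ :=
  ((n : ℂ) + 1)⁻¹ * ∑ m ∈ Finset.range (n + 1), ∑ k ∈ Finset.Icc (-(m : ℤ)) (m : ℤ),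
    fourier (-k) (t : Torus)

theorem continuous_fejerKernel (n : ℕ) : Continuous (fejerKernel n) := by
  unfold fejerKernel
  have (k : ℤ) : Continuous fun t : ℝ => fourier k (t : Torus) :=
    (fourier k).continuous.comp (AddCircle.continuous_mk' _)
  fun_prop

theorem exists_norm_fejerKernel_le (n : ℕ) : ∃ C, ∀ t, ‖fejerKernel n t‖ ≤ C := by
  refine ⟨‖((n : ℂ) + 1)⁻¹‖ * ∑ m ∈ Finset.range (n + 1), ∑ k ∈ Finset.Icc (-(m : ℤ)) (m : ℤ),
    (1 : ℝ), fun t => ?_⟩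
  rw [fejerKernel, norm_mul]
  gcongr
  refine norm_sum_le_of_le _ fun m _ => norm_sum_le_of_le _ fun k _ => ?_
  rw [fourier_apply, Circle.norm_coe]

theorem fourier_torus_add_neg (k : ℤ) (t : ℝ) :
    fourier k (t : Torus) + fourier (-k) (t : Torus) = ((2 * Real.cos (k * t) : ℝ) : ℂ) := by
  rw [fourier_coe_apply, fourier_coe_apply]
  push_cast
  rw [Complex.two_cos]
  have : (Real.pi : ℂ) ≠ 0 := by exact_mod_cast Real.pi_ne_zero
  congr 2 <;> field_simp

/-- The product form avoids the zero of `1 - cos t`, and its right side telescopes when summed over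
`m`. -/
theorem one_sub_cos_mul_dirichletKernel (m : ℕ) (t : ℝ) :
    (1 - Real.cos t : ℂ) * ∑ k ∈ Finset.Icc (-(m : ℤ)) (m : ℤ), fourier (-k) (t : Torus) =
      ((Real.cos (m * t) - Real.cos ((m + 1) * t) : ℝ) : ℂ) := by
  induction m with
  | zero => simp
  | succ m ih =>
    have hI : Finset.Icc (-((m + 1 : ℕ) : ℤ)) ((m + 1 : ℕ) : ℤ) =
        insert (-((m + 1 : ℕ) : ℤ)) (insert ((m + 1 : ℕ) : ℤ) (Finset.Icc (-(m : ℤ)) (m : ℤ))) := by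
      ext k
      simp only [Finset.mem_Icc, Finset.mem_insert]
      push_cast
      omega
    rw [hI, Finset.sum_insert, Finset.sum_insert, ← add_assoc, neg_neg, mul_add, ih,
      fourier_torus_add_neg, ← Complex.ofReal_one, ← Complex.ofReal_sub, ← Complex.ofReal_mul,
      ← Complex.ofReal_add]
    · congr 1
      push_cast
      have h1 : ((m : ℝ) + 1 + 1) * t = (m + 1) * t + t := by ring
      have h2 : (m : ℝ) * t = (m + 1) * t - t := by ring
      rw [h1, h2, Real.cos_add, Real.cos_sub]
      ring
    · simp
    · simp only [Finset.mem_Icc, Finset.mem_insert]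
      push_cast
      omega

theorem one_sub_cos_mul_fejerKernel (n : ℕ) (t : ℝ) :
    (1 - Real.cos t : ℂ) * fejerKernel n t =
      (((1 - Real.cos ((n + 1) * t)) / (n + 1) : ℝ) : ℂ) := by
  rw [fejerKernel, mul_left_comm, Finset.mul_sum]
  simp_rw [one_sub_cos_mul_dirichletKernel]
  rw [← Complex.ofReal_sum]
  have := Finset.sum_range_sub' (fun m : ℕ => Real.cos (m * t)) (n + 1)
  push_cast at this ⊢
  have h2 := congrArg (fun x : ℝ => (x : ℂ)) this
  push_cast at h2
  rw [h2]
  simp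
  ring

theorem fejerMean_liftIoc_zero (n : ℕ) {g : ℝ → ℂ}
    (hg : IntegrableOn g (Set.Ioc (-Real.pi) (-Real.pi + 2 * Real.pi))) :
    fejerMean n (AddCircle.liftIoc (2 * Real.pi) (-Real.pi) g) 0 =
      (2 * Real.pi : ℂ)⁻¹ * ∫ t in Set.Ioc (-Real.pi) (-Real.pi + 2 * Real.pi),
        fejerKernel n t * g t := by
  have hint (k : ℤ) : IntegrableOn (fun t : ℝ => fourier k (t : Torus) * g t)
      (Set.Ioc (-Real.pi) (-Real.pi + 2 * Real.pi)) := by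
    refine hg.bdd_mul (c := 1)
      ((fourier k).continuous.comp (AddCircle.continuous_mk' _)).aestronglyMeasurable
      (ae_of_all _ fun t => ?_)
    rw [fourier_apply, Circle.norm_coe]
  have hsum (m : ℕ) : ∫ t in Set.Ioc (-Real.pi) (-Real.pi + 2 * Real.pi),
      ∑ k ∈ Finset.Icc (-(m : ℤ)) (m : ℤ), fourier (-k) (t : Torus) * g t =
      ∑ k ∈ Finset.Icc (-(m : ℤ)) (m : ℤ),
        ∫ t in Set.Ioc (-Real.pi) (-Real.pi + 2 * Real.pi), fourier (-k) (t : Torus) * g t :=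
    integral_finsetSum _ fun k _ => hint (-k)
  have hle : -Real.pi ≤ -Real.pi + 2 * Real.pi := by linarith [Real.pi_pos]
  simp only [fejerMean, fourierPartialSum, fejerKernel, fourierCoeff_liftIoc_eq,
    fourierCoeffOn_eq_integral, fourier_eval_zero, mul_one, mul_assoc, Finset.sum_mul]
  rw [integral_const_mul,
    integral_finsetSum _ fun m _ => integrable_finsetSum _ fun k _ => hint (-k)]
  simp_rw [hsum]
  rw [mul_left_comm, Finset.mul_sum (a := (2 * Real.pi : ℂ)⁻¹)]
  congr 1
  refine Finset.sum_congr rfl fun m _ => ?_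
  rw [Finset.mul_sum]
  refine Finset.sum_congr rfl fun k _ => ?_
  rw [intervalIntegral.integral_of_le hle, add_sub_cancel_left]
  simp

/-! ### Logarithmic growth of the resonant means -/

theorem abs_div_one_sub_cos_sub_le {t : ℝ} (h0 : 0 < t) (h1 : t ≤ 1) :
    |t / (1 - Real.cos t) - 2 / t| ≤ 1 := by
  have hb := Real.cos_bound (x := t) (by rwa [abs_of_pos h0])
  rw [abs_of_pos h0] at hb
  have hl := Real.one_sub_sq_div_two_le_cos (x := t)
  have ht2 : t ^ 2 ≤ 1 := by nlinarith
  have ht4 : t ^ 4 ≤ t ^ 2 := by nlinarith [sq_nonneg t]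
  have ht4' : t ^ 4 ≤ t ^ 3 := by nlinarith [pow_pos h0 3]
  have hlow : t ^ 2 / 4 ≤ 1 - Real.cos t := by
    have := (abs_le.1 hb).2
    nlinarith
  have hpos : 0 < 1 - Real.cos t := lt_of_lt_of_le (by positivity) hlow
  have : t / (1 - Real.cos t) - 2 / t =
      (t ^ 2 - 2 * (1 - Real.cos t)) / ((1 - Real.cos t) * t) := by
    field_simp
  rw [this, abs_div, abs_of_pos (mul_pos hpos h0), div_le_one (mul_pos hpos h0)]
  have h3 : t ^ 3 / 4 ≤ (1 - Real.cos t) * t := by nlinarith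
  rw [abs_of_nonneg (by linarith)]
  have := (abs_le.1 hb).2
  linarith

/-- Writing `cos u (1 - cos u) = -1/2 + cos u - cos (2u) / 2` and integrating by parts suggests the
first three terms. They leave the error `(-sin u + sin (2u) / 4) / u²`, which the derivative of
`-(5/4) u⁻¹` compensates. -/
theorem hasDerivAt_logSinMajorant {u : ℝ} (hu : 0 < u) :
    HasDerivAt (fun u => -(1 / 2) * Real.log u + Real.sin u / u - Real.sin (2 * u) / (4 * u) -
      5 / 4 * u⁻¹)
      (-(1 / 2) * u⁻¹ + (Real.cos u * u - Real.sin u) / u ^ 2 -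
        (2 * Real.cos (2 * u) * (4 * u) - Real.sin (2 * u) * 4) / (4 * u) ^ 2 +
        5 / 4 * (u ^ 2)⁻¹) u := by
  have h2 : HasDerivAt (fun u : ℝ => 2 * u) 2 u := by
    simpa using (hasDerivAt_id u).const_mul (2 : ℝ)
  have h4 : HasDerivAt (fun u : ℝ => 4 * u) 4 u := by
    simpa using (hasDerivAt_id u).const_mul (4 : ℝ)
  convert! ((((Real.hasDerivAt_log hu.ne').const_mul (-(1 / 2))).add
    ((Real.hasDerivAt_sin u).div (hasDerivAt_id u) hu.ne')).sub
    (h2.sin.div h4 (by positivity))).sub ((hasDerivAt_inv hu.ne').const_mul (5 / 4)) using 1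
  simp only [id]
  ring

theorem integral_cos_mul_one_sub_cos_div_le {X : ℝ} (hX : 1 ≤ X) :
    ∫ u in (1 : ℝ)..X, Real.cos u * (1 - Real.cos u) / u ≤ 4 - Real.log X / 2 := by
  have hd {u : ℝ} (hu : 1 ≤ u) := hasDerivAt_logSinMajorant (zero_lt_one.trans_le hu)
  have key := intervalIntegral.integral_le_sub_of_hasDeriv_right_of_le hX
    (φ := fun u => Real.cos u * (1 - Real.cos u) / u)
    (fun u hu => (hd hu.1).continuousAt.continuousWithinAt)
    (fun u hu => (hd hu.1.le).hasDerivWithinAt) ?_ ?_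
  · refine key.trans ?_
    have hX0 : 0 < X := by linarith
    have h1 : Real.sin X / X ≤ 1 := by
      rw [div_le_one hX0]
      linarith [Real.sin_le_one X]
    have h2 : -(1 / 4) ≤ Real.sin (2 * X) / (4 * X) := by
      rw [le_div_iff₀ (by positivity)]
      linarith [Real.neg_one_le_sin (2 * X)]
    have h3 : 0 < X⁻¹ := by positivity
    have h4 : 0 ≤ Real.sin 1 := Real.sin_nonneg_of_nonneg_of_le_pi zero_le_one (by
      linarith [Real.pi_gt_three])
    have h5 := Real.sin_le_one (2 * 1)
    simp only [Real.log_one, inv_one, div_one, mul_one, mul_zero] at h5 ⊢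
    linarith
  · refine ContinuousOn.integrableOn_Icc (ContinuousOn.div (by fun_prop) (by fun_prop) ?_)
    intro u hu
    exact (zero_lt_one.trans_le hu.1).ne'
  · intro u hu
    have hu0 : 0 < u := zero_lt_one.trans hu.1
    have hs := Real.sin_le_one u
    have hs2 := Real.neg_one_le_sin (2 * u)
    rw [← sub_nonneg]
    have : -(1 / 2) * u⁻¹ + (Real.cos u * u - Real.sin u) / u ^ 2 -
        (2 * Real.cos (2 * u) * (4 * u) - Real.sin (2 * u) * 4) / (4 * u) ^ 2 +
        5 / 4 * (u ^ 2)⁻¹ - Real.cos u * (1 - Real.cos u) / u =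
        (5 / 4 - Real.sin u + Real.sin (2 * u) / 4) / u ^ 2 := by
      rw [Real.cos_two_mul]
      field_simp
      ring
    rw [this]
    exact div_nonneg (by linarith) (by positivity)

theorem abs_one_sub_cos_le (x : ℝ) : |1 - Real.cos x| ≤ |x| := by
  have hcos := Real.one_sub_sq_div_two_le_cos (x := x)
  rw [abs_of_nonneg (by linarith [Real.cos_le_one x])]
  rw [← sq_abs] at hcos
  rcases le_total |x| 2 with h2 | h2
  · nlinarith [abs_nonneg x]
  · linarith [Real.neg_one_le_cos x]

theorem abs_cos_mul_one_sub_cos_div_le (u : ℝ) : |Real.cos u * (1 - Real.cos u) / u| ≤ 1 := by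
  rw [abs_div, abs_mul]
  -- This covers `u = 0` too, where the quotient is 0 by convention.
  refine div_le_one_of_le₀ ?_ (abs_nonneg u)
  exact (mul_le_of_le_one_left (abs_nonneg _) (Real.abs_cos_le_one u)).trans (abs_one_sub_cos_le u)

theorem intervalIntegrable_cos_mul_one_sub_cos_div (a b : ℝ) :
    IntervalIntegrable (fun u => Real.cos u * (1 - Real.cos u) / u) volume a b := by
  refine (intervalIntegrable_const (c := (1 : ℝ))).mono_fun' ?_
    (ae_of_all _ abs_cos_mul_one_sub_cos_div_le)
  exact Measurable.aestronglyMeasurable (by fun_prop)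

theorem integral_zero_cos_mul_one_sub_cos_div_le {X : ℝ} (hX : 1 ≤ X) :
    ∫ u in (0 : ℝ)..X, Real.cos u * (1 - Real.cos u) / u ≤ 5 - Real.log X / 2 := by
  have hi := intervalIntegrable_cos_mul_one_sub_cos_div
  rw [← intervalIntegral.integral_add_adjacent_intervals (hi 0 1) (hi 1 X)]
  have h1 := intervalIntegral.norm_integral_le_of_norm_le_const (a := 0) (b := 1)
    (f := fun u => Real.cos u * (1 - Real.cos u) / u) (C := 1)
    fun u _ => abs_cos_mul_one_sub_cos_div_le u
  rw [sub_zero, abs_one, mul_one] at h1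
  linarith [integral_cos_mul_one_sub_cos_div_le hX, (abs_le.1 h1).2]

theorem fejerKernel_mul_oscBump {n : ℕ} {m t : ℝ} (hm : 1 ≤ m) (hn : (n : ℝ) + 1 = m ^ 2)
    (ht : t ∈ Set.Ioc 0 m⁻¹) :
    fejerKernel n t * (oscBump m t : ℂ) =
      ((t / (1 - Real.cos t) * (Real.cos (m ^ 2 * t) * (1 - Real.cos (m ^ 2 * t))) : ℝ) : ℂ) := by
  have hcos : (1 - Real.cos t : ℂ) ≠ 0 := by
    have : Real.cos t < 1 := by
      rw [← Real.cos_zero]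
      exact Real.cos_lt_cos_of_nonneg_of_le_pi le_rfl
        (by linarith [ht.2, inv_le_one_of_one_le₀ hm, Real.pi_gt_three]) ht.1
    exact_mod_cast (sub_pos.2 this).ne'
  have hm0 : (m : ℂ) ≠ 0 := by
    exact_mod_cast (zero_lt_one.trans_le hm).ne'
  have key := one_sub_cos_mul_fejerKernel n t
  rw [hn, mul_comm, ← eq_div_iff hcos] at key
  rw [key, oscBump, Set.indicator_of_mem ht]
  push_cast
  field_simp

theorem log_sub_le_norm_integral_fejerKernel_mul_oscBump {n : ℕ} {m : ℝ} (hm : 1 ≤ m)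
    (hn : (n : ℝ) + 1 = m ^ 2) :
    Real.log m - 12 ≤ ‖∫ t in Set.Ioc (-Real.pi) (-Real.pi + 2 * Real.pi),
      fejerKernel n t * (oscBump m t : ℂ)‖ := by
  have hm0 : 0 < m := zero_lt_one.trans_le hm
  have hm1 : m⁻¹ ≤ 1 := inv_le_one_of_one_le₀ hm
  have hmi : 0 < m⁻¹ := by positivity
  set A : ℝ → ℝ := fun t =>
    t / (1 - Real.cos t) * (Real.cos (m ^ 2 * t) * (1 - Real.cos (m ^ 2 * t))) with hA
  have hsub : Set.Ioc 0 m⁻¹ ⊆ Set.Ioc (-Real.pi) (-Real.pi + 2 * Real.pi) :=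
    Set.Ioc_subset_Ioc (by linarith [Real.pi_pos]) (by linarith [Real.pi_gt_three])
  have hint : ∫ t in Set.Ioc (-Real.pi) (-Real.pi + 2 * Real.pi),
      fejerKernel n t * (oscBump m t : ℂ) = ((∫ t in (0 : ℝ)..m⁻¹, A t : ℝ) : ℂ) := by
    rw [setIntegral_eq_of_subset_of_forall_sdiff_eq_zero measurableSet_Ioc hsub,
      intervalIntegral.integral_of_le hmi.le, ← integral_complex_ofReal]
    · exact setIntegral_congr_fun measurableSet_Ioc fun t ht => fejerKernel_mul_oscBump hm hn ht
    · intro t ht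
      rw [oscBump, Set.indicator_of_notMem ht.2, Complex.ofReal_zero, mul_zero]
  have hbound {t : ℝ} (ht : t ∈ Set.Ioc 0 m⁻¹) :
      |A t - 2 * m ^ 2 * (Real.cos (m ^ 2 * t) * (1 - Real.cos (m ^ 2 * t)) / (m ^ 2 * t))| ≤
        2 := by
    have ht0 : t ≠ 0 := ht.1.ne'
    have : A t - 2 * m ^ 2 * (Real.cos (m ^ 2 * t) * (1 - Real.cos (m ^ 2 * t)) / (m ^ 2 * t)) =
        (t / (1 - Real.cos t) - 2 / t) *
          (Real.cos (m ^ 2 * t) * (1 - Real.cos (m ^ 2 * t))) := by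
      rw [hA, sub_mul]
      congr 1
      field_simp
    rw [this, abs_mul, abs_mul]
    have h1 := abs_div_one_sub_cos_sub_le ht.1 (ht.2.trans hm1)
    have h2 := Real.abs_cos_le_one (m ^ 2 * t)
    have h3 : |1 - Real.cos (m ^ 2 * t)| ≤ 2 := by
      rw [abs_le]
      constructor <;> linarith [Real.cos_le_one (m ^ 2 * t), Real.neg_one_le_cos (m ^ 2 * t)]
    calc _ ≤ 1 * (1 * (2 : ℝ)) := by gcongr
      _ = 2 := by norm_num
  have hψ : IntervalIntegrable (fun t => 2 * m ^ 2 *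
      (Real.cos (m ^ 2 * t) * (1 - Real.cos (m ^ 2 * t)) / (m ^ 2 * t))) volume 0 m⁻¹ := by
    refine (intervalIntegrable_const (c := 2 * m ^ 2)).mono_fun' ?_ (ae_of_all _ fun t => ?_)
    · exact Measurable.aestronglyMeasurable (by fun_prop)
    · dsimp only
      rw [Real.norm_eq_abs, abs_mul, abs_of_pos (by positivity : 0 < 2 * m ^ 2)]
      exact mul_le_of_le_one_right (by positivity) (abs_cos_mul_one_sub_cos_div_le _)
  have hAint : IntervalIntegrable A volume 0 m⁻¹ := by
    have hd : IntervalIntegrable (fun t => A t - 2 * m ^ 2 *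
        (Real.cos (m ^ 2 * t) * (1 - Real.cos (m ^ 2 * t)) / (m ^ 2 * t))) volume 0 m⁻¹ := by
      refine (intervalIntegrable_const (c := (2 : ℝ))).mono_fun' ?_ ?_
      · exact Measurable.aestronglyMeasurable (by fun_prop)
      · rw [Set.uIoc_of_le hmi.le]
        exact (ae_restrict_iff' measurableSet_Ioc).2 (ae_of_all _ fun t ht => hbound ht)
    -- `A` is a bounded function plus the integrable model kernel.
    simpa using hd.add hψ
  have hle : ∫ t in (0 : ℝ)..m⁻¹, A t ≤ 12 - Real.log m := by
    have hdiff := intervalIntegral.norm_integral_le_of_norm_le_const (a := 0) (b := m⁻¹)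
      (f := fun t => A t - 2 * m ^ 2 *
        (Real.cos (m ^ 2 * t) * (1 - Real.cos (m ^ 2 * t)) / (m ^ 2 * t)))
      (C := 2) fun t ht => hbound (by rwa [Set.uIoc_of_le hmi.le] at ht)
    rw [intervalIntegral.integral_sub hAint hψ, intervalIntegral.integral_const_mul,
      intervalIntegral.integral_comp_mul_left
        (fun u => Real.cos u * (1 - Real.cos u) / u) (by positivity : m ^ 2 ≠ 0),
      sub_zero, abs_of_pos hmi, Real.norm_eq_abs, mul_zero, smul_eq_mul,
      show m ^ 2 * m⁻¹ = m by field_simp, ← mul_assoc,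
      show 2 * m ^ 2 * (m ^ 2)⁻¹ = 2 by field_simp] at hdiff
    -- `12 = 2 · 5 + 2`: twice the model bound, plus an error `2 m⁻¹ ≤ 2`.
    linarith [(abs_le.1 hdiff).2, integral_zero_cos_mul_one_sub_cos_div_le hm]
  rw [hint, Complex.norm_real, Real.norm_eq_abs]
  linarith [neg_le_abs (∫ t in (0 : ℝ)..m⁻¹, A t)]

/-! ### Uniform boundedness on `ℓ¹` -/

/-- A uniform boundedness principle for summation methods acting on `ℓ¹`: if every row of the
matrix `σ` is bounded but `σ` is not, then some `ℓ¹` sequence is mapped to a divergent one. -/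
theorem exists_summable_norm_not_tendsto_tsum {σ : ℕ → ℕ → ℂ} (hrow : ∀ n, ∃ C, ∀ j, ‖σ n j‖ ≤ C)
    (hunb : ∀ C : ℝ, ∃ n j, C < ‖σ n j‖) :
    ∃ c : ℕ → ℂ, (Summable fun j => ‖c j‖) ∧
      ¬ ∃ L, Tendsto (fun n => ∑' j, c j * σ n j) atTop (𝓝 L) := by
  by_contra! hcon
  have hsum (c : lp (fun _ : ℕ => ℂ) 1) : Summable fun j => ‖c j‖ := by
    simpa using (lp.memℓp c).summable (by simp)
  have hnorm (c : lp (fun _ : ℕ => ℂ) 1) : ‖c‖ = ∑' j, ‖c j‖ := by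
    simpa using lp.norm_eq_tsum_rpow (by simp) c
  choose C hC using hrow
  have hbd (n : ℕ) (c : lp (fun _ : ℕ => ℂ) 1) (j : ℕ) : ‖c j * σ n j‖ ≤ C n * ‖c j‖ := by
    rw [norm_mul, mul_comm]
    gcongr
    exact hC n j
  have hsm (n : ℕ) (c : lp (fun _ : ℕ => ℂ) 1) : Summable fun j => c j * σ n j :=
    Summable.of_norm_bounded ((hsum c).mul_left (C n)) (hbd n c)
  let T (n : ℕ) : lp (fun _ : ℕ => ℂ) 1 →L[ℂ] ℂ := LinearMap.mkContinuous
    { toFun := fun c => ∑' j, c j * σ n j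
      map_add' := fun c d => by
        rw [← (hsm n c).tsum_add (hsm n d)]
        exact tsum_congr fun j => add_mul _ _ _
      map_smul' := fun a c => by
        rw [RingHom.id_apply, smul_eq_mul, ← tsum_mul_left]
        exact tsum_congr fun j => mul_assoc _ _ _ } (C n) fun c => by
      rw [hnorm, ← tsum_mul_left]
      exact tsum_of_norm_bounded ((hsum c).mul_left (C n)).hasSum (hbd n c)
  have hT (n : ℕ) (c : lp (fun _ : ℕ => ℂ) 1) : T n c = ∑' j, c j * σ n j := rfl
  obtain ⟨B, hB⟩ := banach_steinhaus (g := T) fun c => by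
    obtain ⟨L, hL⟩ := hcon c (hsum c)
    obtain ⟨B, hB⟩ := (Metric.isBounded_range_of_tendsto _ hL).exists_norm_le
    exact ⟨B, fun n => hB _ ⟨n, rfl⟩⟩
  obtain ⟨n, j, hj⟩ := hunb B
  -- Unit vectors have norm 1, so a bound on `‖T n‖` bounds every matrix entry.
  have h1 : T n (lp.single 1 j (1 : ℂ)) = σ n j := by
    rw [hT, tsum_eq_single j]
    · simp
    · intro i hi
      rw [lp.single_apply_ne _ _ _ hi, zero_mul]
  have h2 := (T n).le_of_opNorm_le (hB n) (lp.single 1 j (1 : ℂ))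
  rw [h1, lp.norm_single (by simp), norm_one, mul_one] at h2
  exact h2.not_gt hj

/-! ### Series of bumps and the counterexample -/

/-- The combination `∑ c_j b_{j+1}` of the oscillating bumps `b_m`. -/
noncomputable def oscSeries (c : ℕ → ℂ) (t : ℝ) : ℂ :=
  ∑' j : ℕ, c j * (oscBump (j + 1) t : ℂ)

theorem integrable_ofReal_oscBump (m : ℝ) : Integrable fun t => (oscBump m t : ℂ) :=
  (integrable_oscBump m).ofReal

theorem integral_norm_ofReal_oscBump_le (j : ℕ) (s : Set ℝ) :
    ∫ t in s, ‖(oscBump (j + 1) t : ℂ)‖ ≤ 1 := by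
  refine (setIntegral_le_integral (integrable_ofReal_oscBump _).norm
    (ae_of_all _ fun t => norm_nonneg _)).trans ?_
  simpa using integral_abs_oscBump_le (m := (j : ℝ) + 1) (by positivity)

theorem integrable_oscSeries {c : ℕ → ℂ} (hc : Summable fun j => ‖c j‖) :
    Integrable (oscSeries c) := by
  refine integrable_tsum_of_summable_integral_norm
    (fun j => (Complex.measurable_ofReal.comp (measurable_oscBump _)).const_mul _)
    (fun j => (integrable_ofReal_oscBump _).const_mul _) ?_
  refine hc.of_nonneg_of_le (fun j => by positivity) fun j => ?_
  simp_rw [norm_mul, integral_const_mul]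
  refine mul_le_of_le_one_right (norm_nonneg _) ?_
  simpa using integral_norm_ofReal_oscBump_le j Set.univ

theorem hasSum_setIntegral_mul_oscSeries {c : ℕ → ℂ} (hc : Summable fun j => ‖c j‖) (s : Set ℝ)
    {φ : ℝ → ℂ} (hφ : Continuous φ) {C : ℝ} (hC : ∀ t, ‖φ t‖ ≤ C) :
    HasSum (fun j : ℕ => c j * ∫ t in s, φ t * (oscBump (j + 1) t : ℂ))
      (∫ t in s, φ t * oscSeries c t) :=
  hasSum_integral_mul_tsum (fun _ => (integrable_ofReal_oscBump _).integrableOn)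
    (fun j => integral_norm_ofReal_oscBump_le j s) hc hφ.aestronglyMeasurable hC

theorem hasSum_intervalIntegral_oscSeries {c : ℕ → ℂ} (hc : Summable fun j => ‖c j‖) (h : ℝ) :
    HasSum (fun j : ℕ => c j * ((∫ t in (0 : ℝ)..h, oscBump (j + 1) t : ℝ) : ℂ))
      (∫ t in (0 : ℝ)..h, oscSeries c t) := by
  have key (s : Set ℝ) := hasSum_setIntegral_mul_oscSeries hc s (φ := fun _ => 1)
    continuous_const (C := 1) (by simp)
  simp only [one_mul] at key
  simp_rw [← intervalIntegral.integral_ofReal, intervalIntegral, mul_sub]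
  exact (key _).sub (key _)

theorem tendsto_inv_mul_integral_oscSeries {c : ℕ → ℂ} (hc : Summable fun j => ‖c j‖) :
    Tendsto (fun h : ℝ => (h : ℂ)⁻¹ * ∫ t in (0 : ℝ)..h, oscSeries c t) (𝓝[≠] 0) (𝓝 0) := by
  have hb (j : ℕ) : (0 : ℝ) < (j : ℝ) + 1 := by positivity
  simp_rw [← (hasSum_intervalIntegral_oscSeries hc _).tsum_eq, ← tsum_mul_left]
  rw [← tsum_zero (α := ℂ) (β := ℕ)]
  -- The quadratic bound gives each termwise limit; the uniform linear bound gives the majorant `2‖c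
  -- j‖`.
  refine tendsto_tsum_of_dominated_convergence (hc.mul_left 2) (fun j => ?_) ?_
  · have hlim : Tendsto (fun h : ℝ => ‖c j‖ * (((j : ℝ) + 1) ^ 2 * |h|)) (𝓝[≠] 0) (𝓝 0) := by
      have : Continuous fun h : ℝ => ‖c j‖ * (((j : ℝ) + 1) ^ 2 * |h|) := by fun_prop
      simpa using (this.tendsto 0).mono_left nhdsWithin_le_nhds
    refine squeeze_zero_norm' ?_ hlim
    filter_upwards [self_mem_nhdsWithin] with h hh
    have hh' : 0 < |h| := abs_pos.2 hh
    rw [norm_mul, norm_mul, norm_inv, Complex.norm_real, Complex.norm_real, Real.norm_eq_abs,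
      Real.norm_eq_abs, inv_mul_le_iff₀ hh']
    calc _ ≤ ‖c j‖ * (((j : ℝ) + 1) ^ 2 * h ^ 2) := by
          gcongr
          exact abs_integral_oscBump_le_sq _ h
      _ = |h| * (‖c j‖ * (((j : ℝ) + 1) ^ 2 * |h|)) := by
          rw [← sq_abs h]
          ring
  · filter_upwards [self_mem_nhdsWithin] with h hh j
    have hh' : 0 < |h| := abs_pos.2 hh
    rw [norm_mul, norm_mul, norm_inv, Complex.norm_real, Complex.norm_real, Real.norm_eq_abs,
      Real.norm_eq_abs, inv_mul_le_iff₀ hh']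
    calc _ ≤ ‖c j‖ * (2 * |h|) := by
          gcongr
          exact abs_integral_oscBump_le (hb j) h
      _ = |h| * (2 * ‖c j‖) := by ring

theorem isDPoint_liftIoc_oscSeries {c : ℕ → ℂ} (hc : Summable fun j => ‖c j‖) :
    IsDPoint (AddCircle.liftIoc (2 * Real.pi) (-Real.pi) (oscSeries c)) 0 := by
  refine ⟨0, (tendsto_inv_mul_integral_oscSeries hc).congr' ?_⟩
  have hmem : Set.Ioo (-Real.pi) Real.pi ∈ 𝓝 (0 : ℝ) :=
    Ioo_mem_nhds (by linarith [Real.pi_pos]) Real.pi_pos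
  filter_upwards [nhdsWithin_le_nhds hmem] with h hh
  congr 1
  refine intervalIntegral.integral_congr fun t ht => ?_
  have ht' : t ∈ Set.Ioo (-Real.pi) Real.pi :=
    Set.ordConnected_Ioo.uIcc_subset (mem_of_mem_nhds hmem) hh ht
  rw [zero_add, AddCircle.liftIoc_coe_apply]
  exact ⟨ht'.1, by linarith [ht'.2]⟩

theorem corollary4 :
    ∃ f : Torus → ℂ, Integrable f AddCircle.haarAddCircle ∧
      IsDPoint f 0 ∧
      ¬ ∃ L : ℂ, Tendsto (fun n : ℕ => fejerMean n f 0) atTop (𝓝 L) := by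
  let σ (n j : ℕ) : ℂ := (2 * Real.pi : ℂ)⁻¹ *
    ∫ t in Set.Ioc (-Real.pi) (-Real.pi + 2 * Real.pi),
      fejerKernel n t * (oscBump (j + 1) t : ℂ)
  have hrow (n : ℕ) : ∃ C, ∀ j, ‖σ n j‖ ≤ C := by
    obtain ⟨C, hC⟩ := exists_norm_fejerKernel_le n
    refine ⟨‖(2 * Real.pi : ℂ)⁻¹‖ * C, fun j => ?_⟩
    have hC0 : 0 ≤ C := (norm_nonneg _).trans (hC 0)
    rw [norm_mul]
    gcongr
    refine (norm_integral_le_of_norm_le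
      ((integrable_ofReal_oscBump (j + 1)).norm.const_mul C).integrableOn
      (ae_of_all _ fun t => ?_)).trans ?_
    · rw [norm_mul]
      gcongr
      exact hC t
    · rw [integral_const_mul]
      exact mul_le_of_le_one_right hC0 (integral_norm_ofReal_oscBump_le j _)
  have hunb (C : ℝ) : ∃ n j, C < ‖σ n j‖ := by
    have hlog : Tendsto (fun j : ℕ => Real.log ((j : ℝ) + 1)) atTop atTop :=
      Real.tendsto_log_atTop.comp
        (tendsto_atTop_add_const_right _ _ tendsto_natCast_atTop_atTop)
    obtain ⟨j, hj⟩ := (hlog.eventually_gt_atTop (12 + 2 * Real.pi * C)).exists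
    -- The resonant order: `n + 1 = m²` with `m = j + 1`.
    refine ⟨(j + 1) ^ 2 - 1, j, ?_⟩
    have hn : (((j + 1) ^ 2 - 1 : ℕ) : ℝ) + 1 = ((j : ℝ) + 1) ^ 2 := by
      rw [Nat.cast_sub (Nat.one_le_pow _ _ (Nat.succ_pos j))]
      push_cast
      ring
    have key := log_sub_le_norm_integral_fejerKernel_mul_oscBump (m := (j : ℝ) + 1)
      (by linarith [Nat.cast_nonneg (α := ℝ) j]) hn
    have hpi : ‖(2 * Real.pi : ℂ)⁻¹‖ = (2 * Real.pi)⁻¹ := by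
      rw [norm_inv, norm_mul, Complex.norm_real, Real.norm_of_nonneg Real.pi_pos.le]
      simp
    rw [norm_mul, hpi, lt_inv_mul_iff₀ Real.two_pi_pos]
    linarith
  obtain ⟨c, hc, hdiv⟩ := exists_summable_norm_not_tendsto_tsum hrow hunb
  have hint := integrable_oscSeries hc
  refine ⟨AddCircle.liftIoc (2 * Real.pi) (-Real.pi) (oscSeries c), ?_,
    isDPoint_liftIoc_oscSeries hc, ?_⟩
  · exact memLp_one_iff_integrable.1
      (memLp_one_iff_integrable.2 hint.integrableOn).memLp_liftIoc.haarAddCircle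
  · have hσ (n : ℕ) : fejerMean n (AddCircle.liftIoc (2 * Real.pi) (-Real.pi) (oscSeries c)) 0 =
        ∑' j, c j * σ n j := by
      obtain ⟨C, hC⟩ := exists_norm_fejerKernel_le n
      rw [fejerMean_liftIoc_zero n hint.integrableOn,
        ← (hasSum_setIntegral_mul_oscSeries hc _ (continuous_fejerKernel n) hC).tsum_eq,
        ← tsum_mul_left]
      exact tsum_congr fun j => mul_left_comm _ _ _
    simpa only [hσ] using hdiv
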